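/- Let $k$ be an algebraically closed field, let $\Gamma=(\Gamma_0,\Gamma_1,s,e)$ be a finite acyclic quiver, and let $\mathcal A=(A_v)_{v\in\Gamma_0}$ be a family of finite-dimensional basic $k$-algebras, each presented as $A_v\cong k\Sigma_v/\Omega_v$ with $\Sigma_v$ a finite quiver and $\Omega_v$ an admissible ideal of the path algebra $k\Sigma_v$. A relation over $\Gamma$ is a $k$-linear combination of distinct paths of length at least two with a common starting vertex and a common ending vertex. Let $I$ be a set of relations over $\Gamma$ that generates an admissible ideal of $k\Gamma$. Let $k(\Gamma,\mathcal A)$ be the generalized path algebra: it is spanned by the $\mathcal A$-paths $a_1\beta_1a_2\cdots a_n\beta_na_{n+1}$ ($n\ge 0$, $\beta_1\cdots\beta_n$ a path of $\Gamma$, $a_j\in A_{s(\beta_j)}$ for $j\le n$ and $a_{n+1}\in A_{e(\beta_n)}$; for $n=0$, elements of the $A_v$), subject to $k$-linearity in each entry $a_j$, with $$(a_1\beta_1\cdots\beta_na_{n+1})(b_1\gamma_1\cdots\gamma_mb_{m+1})=a_1\beta_1\cdots\beta_n(a_{n+1}b_1)\gamma_1\cdots\gamma_mb_{m+1}$$ if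 the first $\mathcal A$-path ends at the vertex where the second one starts, and with product $0$ otherwise. Let $(\mathcal A(I))$ be its two-sided ideal generated by all elements $$\sum_{r}\lambda_r\,\beta_{r1}\overline{\gamma_{r1}}\beta_{r2}\overline{\gamma_{r2}}\cdots\overline{\gamma_{r(m_r-1)}}\beta_{rm_r},$$ where $\sum_r\lambda_r\beta_{r1}\cdots\beta_{rm_r}\in I$ and each $\gamma_{rj}$ is a path of $\Sigma_{e(\beta_{rj})}$ with class $\overline{\gamma_{rj}}\in A_{e(\beta_{rj})}$. Let $\Lambda=k(\Gamma,\mathcal A)/(\mathcal A(I))$ be the generalized bound path algebra, and let $A_{\mathcal A}=\prod_{v\in\Gamma_0}A_v$, with its canonical homomorphism $(a_v)_v\mapsto\sum_v\overline{a_v}$ to $\Lambda$. Write $\operatorname{mod}$ for the category of finitely generated right modules. Then, for every vertex $i\in\Gamma_0$, the cone functor $$\mathcal C_i:\operatorname{mod}A_i\to\operatorname{mod}\Lambda,\qquad \mathcal C_i(M)=M\otimes_{A_{\mathcal A}}\Lambda,$$ where $M$ is regarded as a right $A_{\mathcal A}$-module by $m\cdot(a_v)_v=m\,a_i$, is exact.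 -/

import Mathlib

open CategoryTheory TensorProduct MulOpposite

noncomputable section

namespace GBP

/-! ## The algebra of a category with finitely many objects -/

section CatAlg

universe u v w

/-- The `k`-vector space `⨁_{X, Y} k⟨C(X, Y)⟩` spanned by all morphisms of a small category `C` with
finitely many objects. Morphisms are multiplied by composition, in diagrammatic order (so
`p * q` is "first `p`, then `q`"), and `p * q = 0` if `p` and `q` are not composable. Here
`Free k C` is the category with the same objects as `C` and with
`Hom(X, Y) = k⟨C(X, Y)⟩`, the formal linear combinations of the morphisms from `X` to `Y`. -/
def CatAlg (k : Type u) [Field k] (C : Type v) [Category.{w} C] : Type (max u v w) :=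
  ∀ X Y : C, (Free.of k X ⟶ Free.of k Y)

variable (k : Type u) [Field k] (C : Type v) [Category.{w} C]

instance : AddCommGroup (CatAlg k C) :=
  inferInstanceAs (AddCommGroup (∀ X Y : C, (Free.of k X ⟶ Free.of k Y)))

instance : Module k (CatAlg k C) :=
  inferInstanceAs (Module k (∀ X Y : C, (Free.of k X ⟶ Free.of k Y)))

variable {k C}

/-- The inclusion of the linear combinations of morphisms `X ⟶ Y` into the category algebra. -/
def CatAlg.ofHom (X Y : C) : (Free.of k X ⟶ Free.of k Y) →ₗ[k] CatAlg k C :=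
  letI := Classical.decEq C
  (LinearMap.single k (fun X' : C => ∀ Y' : C, (Free.of k X' ⟶ Free.of k Y')) X).comp
    (LinearMap.single k (fun Y' : C => (Free.of k X ⟶ Free.of k Y')) Y)

variable (k) in
/-- A morphism of `C`, as a morphism of `Free k C`. -/
def freeHom {X Y : C} (p : X ⟶ Y) : Free.of k X ⟶ Free.of k Y :=
  (Finsupp.single p 1 : (X ⟶ Y) →₀ k)

/-- A morphism of `C`, as a basis element of the category algebra. -/
def CatAlg.of {X Y : C} (p : X ⟶ Y) : CatAlg k C :=
  CatAlg.ofHom X Y (freeHom k p)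

theorem freeHom_comp {X Y Z : C} (p : X ⟶ Y) (q : Y ⟶ Z) :
    freeHom k p ≫ freeHom k q = freeHom k (p ≫ q) := by
  refine (Free.single_comp_single k C p q 1 1).trans ?_
  rw [mul_one]
  rfl

theorem freeHom_id (X : C) : freeHom k (𝟙 X) = 𝟙 (Free.of k X) := rfl

theorem CatAlg.ext {f g : CatAlg k C} (h : ∀ X Y, f X Y = g X Y) : f = g :=
  funext fun X => funext fun Y => h X Y

theorem CatAlg.add_apply (f g : CatAlg k C) (X Y : C) : (f + g) X Y = f X Y + g X Y := rfl
theorem CatAlg.zero_apply (X Y : C) : (0 : CatAlg k C) X Y = 0 := rfl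
theorem CatAlg.smul_apply (c : k) (f : CatAlg k C) (X Y : C) : (c • f) X Y = c • f X Y := rfl

open scoped Classical in
instance : One (CatAlg k C) :=
  ⟨fun X Y => if h : X = Y then eqToHom (congrArg (Free.of k) h) else 0⟩

theorem CatAlg.one_apply_self (X : C) : (1 : CatAlg k C) X X = 𝟙 _ := by
  classical
  change (if h : X = X then eqToHom (congrArg (Free.of k) h) else 0) = _
  simp

theorem CatAlg.one_apply_ne {X Y : C} (h : X ≠ Y) : (1 : CatAlg k C) X Y = 0 := by
  classical
  change (if h : X = Y then eqToHom (congrArg (Free.of k) h) else 0) = _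
  simp [h]

theorem CatAlg.ofHom_apply_self (X Y : C) (f : Free.of k X ⟶ Free.of k Y) :
    (CatAlg.ofHom X Y f : CatAlg k C) X Y = f := by
  classical
  change (Pi.single X (Pi.single Y f :
    ∀ Y' : C, (Free.of k X ⟶ Free.of k Y')) : ∀ X' Y' : C, (Free.of k X' ⟶ Free.of k Y')) X Y = f
  convert congrFun (Pi.single_eq_same (M := fun X' : C => ∀ Y' : C, (Free.of k X' ⟶ Free.of k Y'))
    X (Pi.single Y f)) Y using 1
  exact (Pi.single_eq_same (M := fun Y' : C => (Free.of k X ⟶ Free.of k Y')) Y f).symm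

theorem CatAlg.ofHom_apply_ne {X Y X' Y' : C} (f : Free.of k X ⟶ Free.of k Y)
    (h : ¬ (X' = X ∧ Y' = Y)) : (CatAlg.ofHom X Y f : CatAlg k C) X' Y' = 0 := by
  classical
  change (Pi.single X (Pi.single Y f : ∀ Y' : C, (Free.of k X ⟶ Free.of k Y')) :
    ∀ X' Y' : C, (Free.of k X' ⟶ Free.of k Y')) X' Y' = 0
  by_cases hX : X' = X
  · subst hX
    refine (congrFun (Pi.single_eq_same
      (M := fun X' : C => ∀ Y' : C, (Free.of k X' ⟶ Free.of k Y')) X' (Pi.single Y f)) Y').trans ?_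
    exact Pi.single_eq_of_ne (fun hY => h ⟨rfl, hY⟩) f
  · exact congrFun (Pi.single_eq_of_ne (M := fun X' : C => ∀ Y' : C, (Free.of k X' ⟶ Free.of k Y'))
      hX (Pi.single Y f)) Y'

variable [Fintype C]

instance : Mul (CatAlg k C) := ⟨fun f g X Z => ∑ Y : C, f X Y ≫ g Y Z⟩

theorem CatAlg.mul_apply (f g : CatAlg k C) (X Z : C) :
    (f * g) X Z = ∑ Y : C, f X Y ≫ g Y Z := rfl

instance : Ring (CatAlg k C) :=
  { (inferInstance : AddCommGroup (CatAlg k C)), (inferInstance : Mul (CatAlg k C)),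
    (inferInstance : One (CatAlg k C)) with
    left_distrib := fun f g h => CatAlg.ext fun X Z => by
      simp [CatAlg.mul_apply, CatAlg.add_apply, Finset.sum_add_distrib]
    right_distrib := fun f g h => CatAlg.ext fun X Z => by
      simp [CatAlg.mul_apply, CatAlg.add_apply, Finset.sum_add_distrib]
    zero_mul := fun f => CatAlg.ext fun X Z => by
      simp [CatAlg.mul_apply, CatAlg.zero_apply]
    mul_zero := fun f => CatAlg.ext fun X Z => by
      simp [CatAlg.mul_apply, CatAlg.zero_apply]
    mul_assoc := fun f g h => CatAlg.ext fun X Z => by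
      simp only [CatAlg.mul_apply, Preadditive.sum_comp, Preadditive.comp_sum, Category.assoc]
      exact Finset.sum_comm
    one_mul := fun f => CatAlg.ext fun X Z => by
      rw [CatAlg.mul_apply, Finset.sum_eq_single X]
      · rw [CatAlg.one_apply_self, Category.id_comp]
      · intro Y _ h
        rw [CatAlg.one_apply_ne h.symm, Limits.zero_comp]
      · simp
    mul_one := fun f => CatAlg.ext fun X Z => by
      rw [CatAlg.mul_apply, Finset.sum_eq_single Z]
      · rw [CatAlg.one_apply_self, Category.comp_id]
      · intro Y _ h
        rw [CatAlg.one_apply_ne h, Limits.comp_zero]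
      · simp }

instance : Algebra k (CatAlg k C) :=
  Algebra.ofModule
    (fun c f g => CatAlg.ext fun X Z => by
      simp [CatAlg.mul_apply, CatAlg.smul_apply, Finset.smul_sum])
    (fun c f g => CatAlg.ext fun X Z => by
      simp [CatAlg.mul_apply, CatAlg.smul_apply, Finset.smul_sum])

/-- Composable morphisms multiply by composition. -/
theorem CatAlg.of_mul_of {X Y Z : C} (p : X ⟶ Y) (q : Y ⟶ Z) :
    (CatAlg.of p * CatAlg.of q : CatAlg k C) = CatAlg.of (p ≫ q) := by
  apply CatAlg.ext
  intro X' Z'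
  rw [CatAlg.mul_apply]
  simp only [CatAlg.of]
  by_cases h : X' = X ∧ Z' = Z
  · obtain ⟨rfl, rfl⟩ := h
    rw [Finset.sum_eq_single Y]
    · rw [CatAlg.ofHom_apply_self, CatAlg.ofHom_apply_self, CatAlg.ofHom_apply_self]
      exact freeHom_comp p q
    · intro Y' _ hY
      rw [CatAlg.ofHom_apply_ne _ (fun h => hY h.2), Limits.zero_comp]
    · simp
  · rw [CatAlg.ofHom_apply_ne _ h]
    refine Finset.sum_eq_zero fun Y' _ => ?_
    by_cases hX : X' = X
    · rw [CatAlg.ofHom_apply_ne (X := Y) _ (fun hh => h ⟨hX, hh.2⟩), Limits.comp_zero]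
    · rw [CatAlg.ofHom_apply_ne _ (fun hh => hX hh.1), Limits.zero_comp]

/-- Morphisms that are not composable have product zero. -/
theorem CatAlg.of_mul_of_ne {X Y Y' Z : C} (p : X ⟶ Y) (q : Y' ⟶ Z) (h : Y ≠ Y') :
    (CatAlg.of p * CatAlg.of q : CatAlg k C) = 0 := by
  apply CatAlg.ext
  intro X' Z'
  rw [CatAlg.mul_apply, CatAlg.zero_apply]
  refine Finset.sum_eq_zero fun W _ => ?_
  simp only [CatAlg.of]
  by_cases hW : W = Y
  · rw [CatAlg.ofHom_apply_ne (X := Y') _ (fun hh => h (hW.symm.trans hh.1)), Limits.comp_zero]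
  · rw [CatAlg.ofHom_apply_ne _ (fun hh => hW hh.2), Limits.zero_comp]

/-- The unit element is the sum of the identity morphisms. -/
theorem CatAlg.sum_of_id : (∑ X : C, CatAlg.of (𝟙 X) : CatAlg k C) = 1 := by
  apply CatAlg.ext
  intro X Y
  have key : (∑ W : C, CatAlg.of (𝟙 W) : CatAlg k C) X Y =
      ∑ W : C, (CatAlg.of (𝟙 W) : CatAlg k C) X Y := by
    rw [show (∑ W : C, CatAlg.of (𝟙 W) : CatAlg k C) X = ∑ W : C, (CatAlg.of (𝟙 W) : CatAlg k C) X
      from Finset.sum_apply X Finset.univ _]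
    exact Finset.sum_apply Y Finset.univ _
  rw [key, Finset.sum_eq_single X]
  · simp only [CatAlg.of]
    by_cases h : X = Y
    · subst h
      rw [CatAlg.ofHom_apply_self, CatAlg.one_apply_self, freeHom_id]
    · rw [CatAlg.ofHom_apply_ne _ (fun hh => h hh.2.symm), CatAlg.one_apply_ne h]
  · intro W _ hW
    exact CatAlg.ofHom_apply_ne _ (fun hh => hW hh.1.symm)
  · simp

end CatAlg

/-! ## Path algebras, admissible ideals, relations -/

section PathAlg

universe u v w

/-- The path algebra `kQ` of a quiver `Q` with finitely many vertices: the vector space spanned by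
the paths of `Q` (the morphisms of the free category on `Q`), multiplied by concatenation. -/
abbrev PathAlg (k : Type u) [Field k] (Q : Type v) [Quiver.{w} Q] : Type (max u v w) :=
  CatAlg k (Paths Q)

instance (Q : Type v) [Fintype Q] : Fintype (Paths Q) := inferInstanceAs (Fintype Q)

variable (k : Type u) [Field k] {Q : Type v} [Quiver.{w} Q]

/-- A path, as a basis element of the path algebra. -/
def pathElt {a b : Q} (p : Quiver.Path a b) : PathAlg k Q :=
  CatAlg.of (C := Paths Q) (X := a) (Y := b) p

variable (Q) in
/-- `R ^ m`, where `R` is the arrow ideal of `kQ`: the two-sided ideal generated by the paths of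
length `m`. -/
def arrowIdealPow [Fintype Q] (m : ℕ) : TwoSidedIdeal (PathAlg k Q) :=
  TwoSidedIdeal.span {x | ∃ (a b : Q) (p : Quiver.Path a b), p.length = m ∧ x = pathElt k p}

variable {k} in
/-- An ideal `J` of `kQ` is admissible if `R ^ m ⊆ J ⊆ R ^ 2` for some `m ≥ 2`, where `R` is the
arrow ideal. -/
def IsAdmissible [Fintype Q] (J : TwoSidedIdeal (PathAlg k Q)) : Prop :=
  J ≤ arrowIdealPow k Q 2 ∧ ∃ m, 2 ≤ m ∧ arrowIdealPow k Q m ≤ J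

variable (Q) in
/-- A relation over `Q`: a `k`-linear combination of (pairwise distinct) paths of length at least
two that all have the same starting vertex and the same ending vertex. -/
structure PathRel where
  /-- the common starting vertex -/
  source : Q
  /-- the common ending vertex -/
  target : Q
  /-- the linear combination of paths -/
  comb : Quiver.Path source target →₀ k
  two_le_length : ∀ p ∈ comb.support, 2 ≤ p.length

variable {k} in
/-- A relation, as an element of the path algebra. -/
def PathRel.elt (ρ : PathRel k Q) : PathAlg k Q :=
  ∑ p ∈ ρ.comb.support, ρ.comb p • pathElt k p

end PathAlg

/-! ## Generalized path algebras -/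

section GPA

universe u v w x

variable {V : Type v} [Quiver.{w} V]

/-- The `𝒜`-paths `a₁ β₁ a₂ … aₙ βₙ aₙ₊₁` over the quiver `V` with respect to the family
`𝒜 = (A v)_v`, where `β₁ … βₙ` is a path and the `aⱼ` are elements of the algebras at the vertices
that it passes. Those of length zero are the elements of the `A v`. -/
inductive APath (A : V → Type x) : V → V → Type (max v w x)
  | nil {i : V} (a : A i) : APath A i i
  | cons {i j l : V} (p : APath A i j) (β : j ⟶ l) (a : A l) : APath A i l

variable {A : V → Type x}

/-- Multiply the last entry of an `𝒜`-path by `b` on the right. -/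
def APath.mulLast [∀ v, Ring (A v)] {i j : V} : APath A i j → A j → APath A i j
  | .nil a, b => .nil (a * b)
  | .cons p β a, b => .cons p β (a * b)

/-- `(a₁ β₁ … βₙ aₙ₊₁) (b₁ γ₁ … γₘ bₘ₊₁) = a₁ β₁ … βₙ (aₙ₊₁ b₁) γ₁ … γₘ bₘ₊₁`. -/
def APath.comp [∀ v, Ring (A v)] {i j : V} :
    ∀ {l : V}, APath A i j → APath A j l → APath A i l
  | _, p, .nil b => p.mulLast b
  | _, p, .cons q γ b => .cons (p.comp q) γ b

/-- The vertices of the quiver, as the objects of the category of `𝒜`-paths. -/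
@[nolint unusedArguments]
def APathCat (_ : V → Type x) : Type v := V

instance [Fintype V] : Fintype (APathCat A) := inferInstanceAs (Fintype V)

theorem APath.one_comp [∀ v, Ring (A v)] {i j : V} (p : APath A i j) :
    (APath.nil (1 : A i)).comp p = p := by
  induction p with
  | nil a => simp [APath.comp, APath.mulLast]
  | cons p β a ih => simp [APath.comp, ih]

theorem APath.comp_one [∀ v, Ring (A v)] {i j : V} (p : APath A i j) :
    p.comp (APath.nil (1 : A j)) = p := by
  cases p <;> simp [APath.comp, APath.mulLast]

theorem APath.comp_assoc [∀ v, Ring (A v)] {i j l m : V} (p : APath A i j) (q : APath A j l)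
    (r : APath A l m) : (p.comp q).comp r = p.comp (q.comp r) := by
  induction r with
  | nil c => cases q <;> cases p <;> simp [APath.comp, APath.mulLast, mul_assoc]
  | cons r β a ih => simp [APath.comp, ih]

/-- `𝒜`-paths form a category under the multiplication of `𝒜`-paths. -/
instance [∀ v, Ring (A v)] : Category (APathCat A) where
  Hom i j := APath A i j
  id := fun i : V => (APath.nil (1 : A i) : APath A i i)
  comp p q := APath.comp p q
  id_comp p := APath.one_comp p
  comp_id p := APath.comp_one p
  assoc p q r := APath.comp_assoc p q r

variable (k : Type u) [Field k] [∀ v, Ring (A v)]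

variable (A) in
/-- `k[Γ, 𝒜]`, the vector space spanned by all `𝒜`-paths, with the multiplication of `𝒜`-paths
(which is zero on pairs of `𝒜`-paths that are not composable). -/
abbrev PreGPA : Type (max u v w x) := CatAlg k (APathCat A)

/-- An `𝒜`-path, as a basis element of `k[Γ, 𝒜]`. -/
def apathElt {i j : V} (p : APath A i j) : PreGPA A k :=
  CatAlg.of (C := APathCat A) (X := i) (Y := j) p

variable [Fintype V] [∀ v, Algebra k (A v)]

variable (A) in
/-- The space of multilinearity relations in `k[Γ, 𝒜]`. It is spanned by the products `p x q`,
where `p` and `q` are `𝒜`-paths and `x` is one of the two elements below; these products express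
that `𝒜`-paths are additive and `k`-homogeneous in each of their entries `aⱼ`. -/
def multilinearIdeal : TwoSidedIdeal (PreGPA A k) :=
  TwoSidedIdeal.span
    ({x | ∃ (v : V) (a b : A v), x = apathElt k (APath.nil (a + b)) -
        (apathElt k (APath.nil a) + apathElt k (APath.nil b))} ∪
      {x | ∃ (v : V) (c : k) (a : A v), x = apathElt k (APath.nil (c • a)) -
        c • apathElt k (APath.nil a)})

variable (A) in
/-- The generalized path algebra `k(Γ, 𝒜)`. -/
def GPA : Type (max u v w x) := (multilinearIdeal A k).ringCon.Quotient

instance : Ring (GPA A k) := inferInstanceAs (Ring (multilinearIdeal A k).ringCon.Quotient)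
instance : Algebra k (GPA A k) :=
  inferInstanceAs (Algebra k (multilinearIdeal A k).ringCon.Quotient)

variable (A) in
/-- The quotient map `k[Γ, 𝒜] → k(Γ, 𝒜)`. -/
def GPA.mk : PreGPA A k →ₐ[k] GPA A k := RingCon.mkₐ k (multilinearIdeal A k).ringCon

/-- An element `a` of the algebra at `v`, as an element of `k(Γ, 𝒜)`. -/
def GPA.vert {v : V} (a : A v) : GPA A k := GPA.mk A k (apathElt k (APath.nil a))

/-- An arrow `β`, as the element `1 β 1` of `k(Γ, 𝒜)`. -/
def GPA.arrow {v w : V} (β : v ⟶ w) : GPA A k :=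
  GPA.mk A k (apathElt k (APath.cons (APath.nil 1) β 1))

theorem GPA.mk_eq_zero {x : PreGPA A k} (h : x ∈ multilinearIdeal A k) : GPA.mk A k x = 0 := by
  rw [← map_zero (GPA.mk A k)]
  exact (RingCon.eq (multilinearIdeal A k).ringCon).2 ((TwoSidedIdeal.mem_iff _ _).1 h)

theorem GPA.vert_add {v : V} (a b : A v) :
    GPA.vert k (a + b) = GPA.vert k a + GPA.vert k b := by
  rw [← sub_eq_zero]
  simp only [GPA.vert, ← map_add, ← map_sub]
  exact GPA.mk_eq_zero k (TwoSidedIdeal.subset_span (Or.inl ⟨v, a, b, rfl⟩))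

theorem GPA.vert_smul {v : V} (c : k) (a : A v) :
    GPA.vert k (c • a) = c • GPA.vert k a := by
  rw [← sub_eq_zero]
  simp only [GPA.vert, ← map_smul, ← map_sub]
  exact GPA.mk_eq_zero k (TwoSidedIdeal.subset_span (Or.inr ⟨v, c, a, rfl⟩))

theorem GPA.vert_mul {v : V} (a b : A v) :
    GPA.vert k (a * b) = GPA.vert k a * GPA.vert k b := by
  simp only [GPA.vert, ← map_mul]
  exact congrArg (GPA.mk A k) (CatAlg.of_mul_of (k := k) (C := APathCat A) (X := v) (Y := v)
    (Z := v) (APath.nil a) (APath.nil b)).symm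

theorem GPA.vert_mul_ne {v w : V} (h : v ≠ w) (a : A v) (b : A w) :
    GPA.vert k a * GPA.vert k b = 0 := by
  simp only [GPA.vert, ← map_mul]
  exact (congrArg (GPA.mk A k) (CatAlg.of_mul_of_ne (k := k) (C := APathCat A) (X := v) (Y := v)
    (Y' := w) (Z := w) (APath.nil a) (APath.nil b) h)).trans (map_zero _)

theorem GPA.sum_vert_one : ∑ v : V, GPA.vert k (1 : A v) = 1 := by
  simp only [GPA.vert]
  rw [← map_sum, ← map_one (GPA.mk A k)]
  exact congrArg (GPA.mk A k) (CatAlg.sum_of_id (k := k) (C := APathCat A))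

variable (A) in
/-- The inclusion `(a_v)_v ↦ ∑ v, a_v` of the product algebra `A_𝒜 = ∏ v, A v` into
`k(Γ, 𝒜)`. -/
def GPA.incl : (∀ v, A v) →ₐ[k] GPA A k :=
  AlgHom.ofLinearMap
    { toFun := fun a => ∑ v : V, GPA.vert k (a v)
      map_add' := fun a b => by simp [GPA.vert_add, Finset.sum_add_distrib]
      map_smul' := fun c a => by simp [GPA.vert_smul, Finset.smul_sum] }
    (by simpa using GPA.sum_vert_one (A := A) k)
    (fun a b => by
      classical
      simp only [LinearMap.coe_mk, AddHom.coe_mk, Finset.sum_mul_sum, Pi.mul_apply, GPA.vert_mul]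
      refine Finset.sum_congr rfl fun v _ => ?_
      rw [Finset.sum_eq_single v]
      · intro w _ h
        exact GPA.vert_mul_ne k h.symm _ _
      · simp)

end GPA

/-! ## Generalized bound path algebras -/

section GBPA

universe u v w x y z

variable {k : Type u} [Field k] {V : Type v} [Fintype V] [Quiver.{w} V]
  {A : V → Type x} [∀ v, Ring (A v)] [∀ v, Algebra k (A v)]
  {S : V → Type y} [∀ v, Fintype (S v)] [∀ v, Quiver.{z} (S v)]
  (π : ∀ v, PathAlg k (S v) →ₐ[k] A v)

/-- `IsInterleaving π (β₁ … βₘ) x` says that `x ∈ k(Γ, 𝒜)` is of the form `β₁ γ₁ β₂ … γₘ₋₁ βₘ`,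
where each `γⱼ` is the class in `A v = kS_v / Ω_v` of a path of the quiver `S v`,
`v` being the ending vertex of `βⱼ`. -/
inductive IsInterleaving : ∀ {a b : V}, Quiver.Path a b → GPA A k → Prop
  | arrow {a b : V} (β : a ⟶ b) : IsInterleaving β.toPath (GPA.arrow k β)
  | cons {a b c : V} {p : Quiver.Path a b} {x : GPA A k} (hx : IsInterleaving p x)
      {s t : S b} (γ : Quiver.Path s t) (β : b ⟶ c) :
      IsInterleaving (p.cons β) (x * GPA.vert k (π b (pathElt k γ)) * GPA.arrow k β)

/-- The set `𝒜(I) ⊆ k(Γ, 𝒜)`: in a relation `∑ λ_p p` from `I`, each path `p` is replaced by some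
interleaving of `p`, chosen independently of the other summands. -/
def interleavedRelations (I : Set (PathRel k V)) : Set (GPA A k) :=
  {x | ∃ ρ ∈ I, ∃ f : Quiver.Path ρ.source ρ.target → GPA A k,
    (∀ p ∈ ρ.comb.support, IsInterleaving π p (f p)) ∧
      x = ∑ p ∈ ρ.comb.support, ρ.comb p • f p}

/-- The ideal `(𝒜(I))` of `k(Γ, 𝒜)` generated by `𝒜(I)`. -/
def gbpIdeal (I : Set (PathRel k V)) : TwoSidedIdeal (GPA A k) :=
  TwoSidedIdeal.span (interleavedRelations π I)

/-- The generalized bound path algebra `Λ = k(Γ, 𝒜, I) = k(Γ, 𝒜) / (𝒜(I))`. -/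
def GBPA (I : Set (PathRel k V)) : Type (max u v w x) := (gbpIdeal π I).ringCon.Quotient

variable (I : Set (PathRel k V))

instance : Ring (GBPA π I) := inferInstanceAs (Ring (gbpIdeal π I).ringCon.Quotient)
instance : Algebra k (GBPA π I) := inferInstanceAs (Algebra k (gbpIdeal π I).ringCon.Quotient)

/-- The quotient map `k(Γ, 𝒜) → Λ`. -/
def GBPA.mk : GPA A k →ₐ[k] GBPA π I := RingCon.mkₐ k (gbpIdeal π I).ringCon

/-- The canonical homomorphism `A_𝒜 = ∏ v, A v → Λ`. -/
def GBPA.incl : (∀ v, A v) →ₐ[k] GBPA π I := (GBPA.mk π I).comp (GPA.incl A k)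

end GBPA

/-! ## Extension of scalars over noncommutative rings, for right modules

Right `R`-modules are modules over the opposite ring `Rᵐᵒᵖ`. -/

section Extend

universe u v w

variable {R : Type u} {S : Type v} [Ring R] [Ring S] (f : R →+* S)

section

variable (M : Type w) [AddCommGroup M] [Module Rᵐᵒᵖ M]

/-- The relations `(m r) ⊗ s = m ⊗ (f r) s` of the tensor product `M ⊗_R S`. The elementary tensor
`m ⊗ s` is written `s ⊗ₜ m`, so that the right `S`-action is the one on the first factor. -/
def balancedRel : Submodule Sᵐᵒᵖ (S ⊗[ℤ] M) :=
  Submodule.span Sᵐᵒᵖ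
    {x | ∃ (s : S) (r : R) (m : M), x = s ⊗ₜ[ℤ] (op r • m) - (f r * s) ⊗ₜ[ℤ] m}

/-- The right `S`-module `M ⊗_R S`, for a right `R`-module `M` and a ring homomorphism
`f : R → S`, which makes `S` an `R`-`S`-bimodule. -/
abbrev ExtendScalars : Type (max v w) := (S ⊗[ℤ] M) ⧸ balancedRel f M

end

section

variable {M N : Type*} [AddCommGroup M] [Module Rᵐᵒᵖ M] [AddCommGroup N] [Module Rᵐᵒᵖ N]

/-- The elementary tensor `m ⊗ s` of `M ⊗_R S`. -/
def ExtendScalars.tmul (m : M) (s : S) : ExtendScalars f M :=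
  (balancedRel f M).mkQ (s ⊗ₜ[ℤ] m)

theorem ExtendScalars.smul_tmul (m : M) (r : R) (s : S) :
    ExtendScalars.tmul f (op r • m) s = ExtendScalars.tmul f m (f r * s) := by
  rw [← sub_eq_zero, ExtendScalars.tmul, ExtendScalars.tmul, ← map_sub]
  exact (Submodule.Quotient.mk_eq_zero _).2 (Submodule.subset_span ⟨s, r, m, rfl⟩)

theorem ExtendScalars.tmul_smul (m : M) (s t : S) :
    op t • ExtendScalars.tmul f m s = ExtendScalars.tmul f m (s * t) := rfl

/-- The map `g ⊗ id : M ⊗_R S → N ⊗_R S`. -/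
def ExtendScalars.map (g : M →ₗ[Rᵐᵒᵖ] N) : ExtendScalars f M →ₗ[Sᵐᵒᵖ] ExtendScalars f N :=
  Submodule.mapQ _ _ (AlgebraTensorModule.lTensor Sᵐᵒᵖ S g.toAddMonoidHom.toIntLinearMap) (by
    rw [balancedRel, Submodule.span_le]
    rintro _ ⟨s, r, m, rfl⟩
    refine Submodule.subset_span ⟨s, r, g m, ?_⟩
    simp)

@[simp]
theorem ExtendScalars.map_tmul (g : M →ₗ[Rᵐᵒᵖ] N) (m : M) (s : S) :
    ExtendScalars.map f g (ExtendScalars.tmul f m s) = ExtendScalars.tmul f (g m) s := rfl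

theorem ExtendScalars.hom_ext {P : Type*} [AddCommGroup P] [Module Sᵐᵒᵖ P]
    {g h : ExtendScalars f M →ₗ[Sᵐᵒᵖ] P}
    (H : ∀ m s, g (ExtendScalars.tmul f m s) = h (ExtendScalars.tmul f m s)) : g = h := by
  apply LinearMap.ext
  intro x
  obtain ⟨x, rfl⟩ := Submodule.mkQ_surjective _ x
  induction x using TensorProduct.induction_on with
  | zero => simp
  | tmul s m => exact H m s
  | add x y hx hy => rw [map_add, map_add, map_add, hx, hy]

theorem ExtendScalars.finite [Module.Finite Rᵐᵒᵖ M] :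
    Module.Finite Sᵐᵒᵖ (ExtendScalars f M) := by
  obtain ⟨T, hT⟩ := (Module.Finite.fg_top : (⊤ : Submodule Rᵐᵒᵖ M).FG)
  classical
  refine ⟨⟨T.image fun m => ExtendScalars.tmul f m 1, ?_⟩⟩
  rw [eq_top_iff]
  set X := Submodule.span Sᵐᵒᵖ
    ((T.image fun m => ExtendScalars.tmul f m 1 : Finset _) : Set (ExtendScalars f M)) with hX
  have h1 : ∀ (m : M) (s : S), ExtendScalars.tmul f m s ∈ X := by
    intro m
    have hm : m ∈ Submodule.span Rᵐᵒᵖ (T : Set M) := by rw [hT]; trivial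
    induction hm using Submodule.span_induction with
    | mem m hm =>
      intro s
      have := X.smul_mem (op s) (Submodule.subset_span
        (Finset.mem_coe.2 (Finset.mem_image_of_mem _ hm)) : ExtendScalars.tmul f m 1 ∈ X)
      rwa [ExtendScalars.tmul_smul, one_mul] at this
    | zero => intro s; simp [ExtendScalars.tmul]
    | add m n _ _ hm hn =>
      intro s
      have := X.add_mem (hm s) (hn s)
      rwa [ExtendScalars.tmul, ExtendScalars.tmul, ← map_add, ← TensorProduct.tmul_add] at this
    | smul r m _ hm =>
      intro s
      have := hm (f r.unop * s)
      rwa [← ExtendScalars.smul_tmul] at this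
  rintro x -
  obtain ⟨x, rfl⟩ := Submodule.mkQ_surjective _ x
  induction x using TensorProduct.induction_on with
  | zero => rw [map_zero]; exact X.zero_mem
  | tmul s m => exact h1 m s
  | add x y hx hy => rw [map_add]; exact X.add_mem hx hy

end

/-- The functor `- ⊗_R S` from right `R`-modules to right `S`-modules. -/
def extendScalarsFunctor : ModuleCat.{w} Rᵐᵒᵖ ⥤ ModuleCat.{max v w} Sᵐᵒᵖ where
  obj M := ModuleCat.of Sᵐᵒᵖ (ExtendScalars f M)
  map g := ModuleCat.ofHom (ExtendScalars.map f g.hom)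
  map_id M := by
    apply ModuleCat.hom_ext
    apply ExtendScalars.hom_ext
    intro m s
    rfl
  map_comp g h := by
    apply ModuleCat.hom_ext
    apply ExtendScalars.hom_ext
    intro m s
    rfl

end Extend

/-! ## Cones -/

section Cone

universe u v w x y z m

variable {k : Type u} [Field k] {V : Type v} [Fintype V] [Quiver.{w} V]
  {A : V → Type x} [∀ v, Ring (A v)] [∀ v, Algebra k (A v)]
  {S : V → Type y} [∀ v, Fintype (S v)] [∀ v, Quiver.{z} (S v)]
  (π : ∀ v, PathAlg k (S v) →ₐ[k] A v) (I : Set (PathRel k V)) (i : V)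

/-- The cone functor on all right `A i`-modules: a module `M` is regarded as an `A_𝒜`-module by
`m · (a_v)_v = m a_i`, and is sent to `M ⊗_{A_𝒜} Λ`. -/
def bigConeFunctor : ModuleCat.{m} (A i)ᵐᵒᵖ ⥤ ModuleCat.{max u v w x m} (GBPA π I)ᵐᵒᵖ :=
  ModuleCat.restrictScalars (RingHom.op (Pi.evalRingHom A i)) ⋙
    extendScalarsFunctor.{max v x, max u v w x, m} (GBPA.incl π I : (∀ v, A v) →+* GBPA π I)

theorem bigConeFunctor_isFG (M : ModuleCat.{m} (A i)ᵐᵒᵖ) (hM : ModuleCat.isFG _ M) :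
    ModuleCat.isFG _ ((bigConeFunctor π I i).obj M) := by
  have : Module.Finite (A i)ᵐᵒᵖ M := hM
  let g : (∀ v, A v)ᵐᵒᵖ →+* (A i)ᵐᵒᵖ := RingHom.op (Pi.evalRingHom A i)
  have hg : Function.Surjective g := fun a => by
    obtain ⟨b, hb⟩ := Function.surjective_eval i a.unop
    exact ⟨op b, congrArg op hb⟩
  let N := (ModuleCat.restrictScalars g).obj M
  have hN : Module.Finite (∀ v, A v)ᵐᵒᵖ N := by
    obtain ⟨T, hT⟩ := (Module.Finite.fg_top : (⊤ : Submodule (A i)ᵐᵒᵖ M).FG)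
    refine ⟨⟨T, ?_⟩⟩
    rw [eq_top_iff]
    rintro x -
    have hx : (x : M) ∈ Submodule.span (A i)ᵐᵒᵖ (T : Set M) := by rw [hT]; trivial
    induction hx using Submodule.span_induction with
    | mem x hx => exact Submodule.subset_span hx
    | zero => exact Submodule.zero_mem _
    | add x y _ _ hx hy => exact Submodule.add_mem _ hx hy
    | smul r x _ hx =>
      obtain ⟨r, rfl⟩ := hg r
      exact Submodule.smul_mem _ r hx
  exact ExtendScalars.finite (M := N) (GBPA.incl π I : (∀ v, A v) →+* GBPA π I)

/-- The cone functor `𝒞_i : mod A_i → mod Λ`, where `mod` stands for the category of finitely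
generated right modules. -/
def coneFunctor : FGModuleCat.{m} (A i)ᵐᵒᵖ ⥤ FGModuleCat.{max u v w x m} (GBPA π I)ᵐᵒᵖ :=
  (ModuleCat.isFG _).lift ((ModuleCat.isFG _).ι ⋙ bigConeFunctor π I i)
    (fun M => bigConeFunctor_isFG π I i M.obj M.property)

end Cone

end GBP

end

universe u v w x y z m

/-! `Λ` is projective as a left `A_𝒜`-module, because the multiplication `μ : A_𝒜 ⊗_k Λ → Λ` is a
split epimorphism. To split it, let `k(Γ, 𝒜)` act on `A_𝒜 ⊗_k Λ` as follows: `A_𝒜` acts on the first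
factor, and an arrow `β : i ⟶ j` acts by `t ↦ e_i ⊗ β μ(t)`. Then `μ` is equivariant, so an
interleaving `x` of a path from `a` acts by `t ↦ e_a ⊗ x μ(t)`. The right-hand side depends only on
the image of `x` in `Λ`, so the relations in `𝒜(I)` act by zero, the action descends to `Λ`, and
`s ↦ s · (1 ⊗ 1)` is an `A_𝒜`-linear section of `μ`.

A dual basis of a projective left module `S` over a ring `R` makes `M ⊗_R S` a retract of a direct
sum of copies of `M`, naturally in `M`, so `- ⊗_R S` preserves exact sequences. -/

noncomputable section

namespace GBP

/-! ## The universal property of generalized path algebras -/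

section CatAlg

variable {k : Type*} [Field k] {C : Type*} [Category* C] [Fintype C] {E : Type*}

theorem CatAlg.linearMap_ext [AddCommGroup E] [Module k E] {f g : CatAlg k C →ₗ[k] E}
    (h : ∀ {X Y : C} (p : X ⟶ Y), f (CatAlg.of p) = g (CatAlg.of p)) : f = g := by
  classical
  exact LinearMap.pi_ext' fun X => LinearMap.pi_ext' fun Y => Finsupp.lhom_ext' fun p =>
    LinearMap.ext_ring (h p)

/-- The linear map on the category algebra with prescribed values on the morphisms. -/
def CatAlg.linearLift [AddCommGroup E] [Module k E] (F : ∀ {X Y : C}, (X ⟶ Y) → E) :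
    CatAlg k C →ₗ[k] E :=
  letI := Classical.decEq C
  LinearMap.lsum k (fun X : C => ∀ Y : C, (Free.of k X ⟶ Free.of k Y)) k fun X =>
    LinearMap.lsum k (fun Y : C => (Free.of k X ⟶ Free.of k Y)) k fun Y =>
      Finsupp.linearCombination k (F : (X ⟶ Y) → E)

theorem CatAlg.linearLift_of [AddCommGroup E] [Module k E] (F : ∀ {X Y : C}, (X ⟶ Y) → E)
    {X Y : C} (p : X ⟶ Y) : CatAlg.linearLift F (CatAlg.of p : CatAlg k C) = F p := by
  classical
  calc
    _ = Finsupp.linearCombination k (F : (X ⟶ Y) → E) (Finsupp.single p 1) :=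
      (LinearMap.lsum_piSingle k _ _ _ X _).trans (LinearMap.lsum_piSingle k _ _ _ Y _)
    _ = F p := by rw [Finsupp.linearCombination_single, one_smul]

/-- The universal property of the category algebra: a map from the morphisms of `C` to an algebra
extends to an algebra homomorphism if it respects composition and identities and sends pairs of
morphisms that are not composable to elements with product zero. -/
def CatAlg.lift [Ring E] [Algebra k E] (F : ∀ {X Y : C}, (X ⟶ Y) → E)
    (map_comp : ∀ {X Y Z : C} (p : X ⟶ Y) (q : Y ⟶ Z), F (p ≫ q) = F p * F q)
    (mul_of_ne : ∀ {X Y Y' Z : C} (p : X ⟶ Y) (q : Y' ⟶ Z), Y ≠ Y' → F p * F q = 0)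
    (sum_id : ∑ X : C, F (𝟙 X) = 1) : CatAlg k C →ₐ[k] E :=
  AlgHom.ofLinearMap (CatAlg.linearLift F)
    (by rw [← CatAlg.sum_of_id, map_sum, ← sum_id]; simp only [CatAlg.linearLift_of])
    ((LinearMap.map_mul_iff _).2 <| CatAlg.linearMap_ext fun {X Y} p =>
      CatAlg.linearMap_ext fun {Y' Z} q => by
        change CatAlg.linearLift F (CatAlg.of p * CatAlg.of q) =
          CatAlg.linearLift F (CatAlg.of p) * CatAlg.linearLift F (CatAlg.of q)
        obtain rfl | h := eq_or_ne Y Y'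
        · simp only [CatAlg.of_mul_of, CatAlg.linearLift_of, map_comp]
        · simp only [CatAlg.of_mul_of_ne p q h, map_zero, CatAlg.linearLift_of, mul_of_ne p q h])

end CatAlg

/-- The algebra homomorphism induced on the quotient by the two-sided ideal generated by `X`. -/
def quotientSpanLift {k R S : Type*} [CommSemiring k] [Ring R] [Ring S] [Algebra k R]
    [Algebra k S] {X : Set R} (f : R →ₐ[k] S) (hf : ∀ x ∈ X, f x = 0) :
    (TwoSidedIdeal.span X).ringCon.Quotient →ₐ[k] S :=
  (TwoSidedIdeal.span X).ringCon.liftₐ f fun x y hxy => by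
    have hle : TwoSidedIdeal.span X ≤ TwoSidedIdeal.ker f :=
      TwoSidedIdeal.span_le.2 fun x hx => (TwoSidedIdeal.mem_ker f).2 (hf x hx)
    have hsub : f (x - y) = 0 :=
      (TwoSidedIdeal.mem_ker f).1 (hle ((TwoSidedIdeal.rel_iff _ x y).1 hxy))
    exact sub_eq_zero.1 ((map_sub f x y).symm.trans hsub)

section APath

variable {k : Type*} [Field k] {V : Type*} [Quiver V] {A : V → Type*} [∀ v, Ring (A v)]
  [∀ v, Algebra k (A v)] [DecidableEq V] {E : Type*} [Ring E] [Algebra k E]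
  (ι : (∀ v, A v) →ₐ[k] E) (b : ∀ {i j : V}, (i ⟶ j) → E)

/-- The value `ι(a₁) b(β₁) ι(a₂) ⋯ b(βₙ) ι(aₙ₊₁)` at an `𝒜`-path, for a homomorphism `ι` on
`A_𝒜 = ∏ v, A v` and elements `b(β)` indexed by the arrows. -/
def APath.eval : ∀ {i j : V}, APath A i j → E
  | i, _, .nil a => ι (Pi.single i a)
  | _, l, .cons p β a => p.eval * b β * ι (Pi.single l a)

theorem APath.eval_comp {i j l : V} (p : APath A i j) (q : APath A j l) :
    (p.comp q).eval ι b = p.eval ι b * q.eval ι b := by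
  induction q with
  | nil a => cases p <;> simp only [APath.comp, APath.mulLast, APath.eval, Pi.single_mul, map_mul,
      mul_assoc]
  | cons q β a ih => simp only [APath.comp, APath.eval, ih, mul_assoc]

theorem APath.eval_mul_eval_of_ne {i j j' l : V} (p : APath A i j) (q : APath A j' l)
    (h : j ≠ j') : p.eval ι b * q.eval ι b = 0 := by
  have single_mul_single : (Pi.single j 1 * Pi.single j' 1 : ∀ v, A v) = 0 := by
    ext v
    obtain rfl | hv := eq_or_ne v j <;> simp [*]
  calc p.eval ι b * q.eval ι b
      = (p.comp (.nil 1)).eval ι b * (APath.comp (.nil 1) q).eval ι b := by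
        rw [APath.comp_one, APath.one_comp]
    _ = p.eval ι b * ι (Pi.single j 1 * Pi.single j' 1) * q.eval ι b := by
        simp only [APath.eval_comp, APath.eval, map_mul, mul_assoc]
    _ = 0 := by rw [single_mul_single, map_zero, mul_zero, zero_mul]

end APath

section GPA

variable {k : Type*} [Field k] {V : Type*} [Fintype V] [Quiver V]
  {A : V → Type*} [∀ v, Ring (A v)]

theorem apathElt_comp {i j l : V} (p : APath A i j) (q : APath A j l) :
    apathElt k (p.comp q) = apathElt k p * apathElt k q :=
  (CatAlg.of_mul_of (C := APathCat A) (X := i) (Y := j) (Z := l) p q).symm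

variable [∀ v, Algebra k (A v)]

theorem GPA.mk_apathElt_cons {i j l : V} (p : APath A i j) (β : j ⟶ l) (a : A l) :
    GPA.mk A k (apathElt k (p.cons β a)) =
      GPA.mk A k (apathElt k p) * GPA.arrow k β * GPA.vert k a := by
  have factor : p.cons β a = (p.comp (.cons (.nil 1) β 1)).comp (.nil a) := by
    change p.cons β a = (p.comp (.nil 1)).cons β (1 * a)
    rw [APath.comp_one, one_mul]
  rw [factor, apathElt_comp, apathElt_comp, map_mul, map_mul, GPA.arrow, GPA.vert]

theorem GPA.vert_one_mul_arrow {i j : V} (β : i ⟶ j) :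
    GPA.vert k (1 : A i) * GPA.arrow k β = GPA.arrow k β := by
  simp only [GPA.arrow, GPA.vert, ← map_mul, ← apathElt_comp, APath.one_comp]

theorem GPA.arrow_mul_vert_one {i j : V} (β : i ⟶ j) :
    GPA.arrow k β * GPA.vert k (1 : A j) = GPA.arrow k β := by
  simp only [GPA.arrow, GPA.vert, ← map_mul, ← apathElt_comp, APath.comp_one]

theorem GPA.linearMap_ext {E : Type*} [AddCommGroup E] [Module k E] {f g : GPA A k →ₗ[k] E}
    (h : ∀ {i j : V} (p : APath A i j),
      f (GPA.mk A k (apathElt k p)) = g (GPA.mk A k (apathElt k p))) : f = g := by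
  have comp_mk : f ∘ₗ (GPA.mk A k).toLinearMap = g ∘ₗ (GPA.mk A k).toLinearMap :=
    CatAlg.linearMap_ext fun p => h p
  ext x
  obtain ⟨y, rfl⟩ := (multilinearIdeal A k).ringCon.mk'_surjective x
  exact LinearMap.congr_fun comp_mk y

variable [DecidableEq V]

theorem GPA.incl_single (v : V) (a : A v) :
    GPA.incl A k (Pi.single v a) = GPA.vert k a := by
  have vert_zero (w : V) : GPA.vert k (0 : A w) = 0 := by
    simpa using GPA.vert_smul k (0 : k) (0 : A w)
  change ∑ w : V, GPA.vert k ((Pi.single v a : ∀ v, A v) w) = _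
  rw [Finset.sum_eq_single v (fun w _ h => by rw [Pi.single_eq_of_ne h, vert_zero]) (by simp),
    Pi.single_eq_same]

section Lift

variable {E : Type*} [Ring E] [Algebra k E] (ι : (∀ v, A v) →ₐ[k] E)
  (b : ∀ {i j : V}, (i ⟶ j) → E)

/-- The homomorphism on `k[Γ, 𝒜]` that extends `APath.eval`. -/
def PreGPA.lift : PreGPA A k →ₐ[k] E :=
  CatAlg.lift (C := APathCat A) (fun p => APath.eval ι b p) (APath.eval_comp ι b)
    (APath.eval_mul_eval_of_ne ι b) <| by
      change ∑ v : V, APath.eval ι b (.nil 1) = 1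
      simp only [APath.eval]
      rw [← map_sum, ← map_one ι]
      exact congrArg ι (Finset.univ_sum_single (1 : ∀ v, A v))

theorem PreGPA.lift_apathElt {i j : V} (p : APath A i j) :
    PreGPA.lift ι b (apathElt k p) = p.eval ι b :=
  CatAlg.linearLift_of (C := APathCat A) _ _

/-- The universal property of the generalized path algebra: a homomorphism `ι` on `A_𝒜` and a
family of elements `b(β)` indexed by the arrows induce a homomorphism on `k(Γ, 𝒜)`. No relation
between `ι` and `b` is required, because `β : i ⟶ j` is sent to `ι(e_i) b(β) ι(e_j)`. -/
def GPA.lift : GPA A k →ₐ[k] E :=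
  quotientSpanLift (PreGPA.lift ι b) <| by
    rintro _ (⟨v, a, a', rfl⟩ | ⟨v, c, a, rfl⟩)
    · simp only [map_sub, map_add, PreGPA.lift_apathElt, APath.eval, Pi.single_add, sub_self]
    · simp only [map_sub, map_smul, PreGPA.lift_apathElt, APath.eval, Pi.single_smul, sub_self]

theorem GPA.lift_apathElt {i j : V} (p : APath A i j) :
    GPA.lift ι b (GPA.mk A k (apathElt k p)) = p.eval ι b :=
  PreGPA.lift_apathElt ι b p

theorem GPA.lift_incl (r : ∀ v, A v) : GPA.lift ι b (GPA.incl A k r) = ι r := by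
  have lift_vert (v : V) : GPA.lift ι b (GPA.vert k (r v)) = ι (Pi.single v (r v)) := by
    rw [GPA.vert, GPA.lift_apathElt, APath.eval]
  calc GPA.lift ι b (∑ v, GPA.vert k (r v))
      = ι (∑ v, Pi.single v (r v)) := by simp only [map_sum, lift_vert]
    _ = ι r := by rw [Finset.univ_sum_single]

theorem GPA.lift_arrow {i j : V} (β : i ⟶ j) :
    GPA.lift ι b (GPA.arrow k β) = ι (Pi.single i 1) * b β * ι (Pi.single j 1) := by
  rw [GPA.arrow, GPA.lift_apathElt, APath.eval, APath.eval]

end Lift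

end GPA

/-! ## Projectivity of `Λ` over `A_𝒜` -/

section Splitting

variable {k : Type*} [Field k] {V : Type*} [Fintype V] [Quiver V]
  {A : V → Type*} [∀ v, Ring (A v)] [∀ v, Algebra k (A v)]
  {B : Type*} [Ring B] [Algebra k B] (φ : GPA A k →ₐ[k] B)

/-- The multiplication `A_𝒜 ⊗ B → B`, `r ⊗ x ↦ φ(r) x`, for a homomorphism `φ` from `k(Γ, 𝒜)`
to `B`. -/
def GPA.mulMap : (∀ v, A v) ⊗[k] B →ₗ[k] B :=
  LinearMap.mul' k B ∘ₗ LinearMap.rTensor B (φ.comp (GPA.incl A k)).toLinearMap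

theorem GPA.mulMap_tmul (r : ∀ v, A v) (x : B) :
    GPA.mulMap φ (r ⊗ₜ x) = φ (GPA.incl A k r) * x := rfl

theorem GPA.mulMap_smul (r : ∀ v, A v) (t : (∀ v, A v) ⊗[k] B) :
    GPA.mulMap φ (r • t) = φ (GPA.incl A k r) * GPA.mulMap φ t := by
  induction t with
  | zero => simp only [smul_zero, map_zero, mul_zero]
  | tmul r' x =>
    simp only [TensorProduct.smul_tmul', smul_eq_mul, GPA.mulMap_tmul, map_mul, mul_assoc]
  | add t t' ht ht' => simp only [smul_add, map_add, ht, ht', mul_add]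

variable [DecidableEq V]

/-- The endomorphism `t ↦ e_i ⊗ φ(β) μ(t)` of `A_𝒜 ⊗ B` attached to an arrow `β : i ⟶ j`, where
`μ` is the multiplication `GPA.mulMap φ`. -/
def GPA.arrowEnd {i j : V} (β : i ⟶ j) : Module.End k ((∀ v, A v) ⊗[k] B) :=
  TensorProduct.mk k (∀ v, A v) B (Pi.single i 1) ∘ₗ
    LinearMap.mulLeft k (φ (GPA.arrow k β)) ∘ₗ GPA.mulMap φ

/-- The action of `k(Γ, 𝒜)` on `A_𝒜 ⊗ B` for which the multiplication `GPA.mulMap φ` is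
equivariant: `A_𝒜` acts by multiplication on the first factor, and the arrows act by
`GPA.arrowEnd`. -/
def GPA.tensorAction : GPA A k →ₐ[k] Module.End k ((∀ v, A v) ⊗[k] B) :=
  GPA.lift (Algebra.lsmul k k _) (GPA.arrowEnd φ)

theorem GPA.tensorAction_incl (r : ∀ v, A v) (t : (∀ v, A v) ⊗[k] B) :
    GPA.tensorAction φ (GPA.incl A k r) t = r • t := by
  rw [GPA.tensorAction, GPA.lift_incl, Algebra.lsmul_coe]

theorem GPA.tensorAction_arrow {i j : V} (β : i ⟶ j) (t : (∀ v, A v) ⊗[k] B) :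
    GPA.tensorAction φ (GPA.arrow k β) t =
      Pi.single i 1 ⊗ₜ (φ (GPA.arrow k β) * GPA.mulMap φ t) := by
  have absorb : GPA.arrow k β * GPA.incl A k (Pi.single j 1) = GPA.arrow k β := by
    rw [GPA.incl_single, GPA.arrow_mul_vert_one]
  rw [GPA.tensorAction, GPA.lift_arrow]
  change (Pi.single i 1 : ∀ v, A v) • ((Pi.single i 1 : ∀ v, A v) ⊗ₜ[k]
    (φ (GPA.arrow k β) * GPA.mulMap φ ((Pi.single j 1 : ∀ v, A v) • t))) = _
  rw [GPA.mulMap_smul, ← mul_assoc, ← map_mul, absorb, TensorProduct.smul_tmul', smul_eq_mul,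
    ← Pi.single_mul, one_mul]

theorem GPA.mulMap_tensorAction (g : GPA A k) (t : (∀ v, A v) ⊗[k] B) :
    GPA.mulMap φ (GPA.tensorAction φ g t) = φ g * GPA.mulMap φ t := by
  have vert {v : V} (a : A v) (t) :
      GPA.mulMap φ (GPA.tensorAction φ (GPA.vert k a) t) = φ (GPA.vert k a) * GPA.mulMap φ t := by
    rw [← GPA.incl_single, GPA.tensorAction_incl, GPA.mulMap_smul]
  have arrow {i j : V} (β : i ⟶ j) (t) :
      GPA.mulMap φ (GPA.tensorAction φ (GPA.arrow k β) t) = φ (GPA.arrow k β) * GPA.mulMap φ t := by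
    rw [GPA.tensorAction_arrow, GPA.mulMap_tmul, GPA.incl_single, ← mul_assoc, ← map_mul,
      GPA.vert_one_mul_arrow]
  have path {i j : V} (p : APath A i j) : ∀ t, GPA.mulMap φ (GPA.tensorAction φ
      (GPA.mk A k (apathElt k p)) t) = φ (GPA.mk A k (apathElt k p)) * GPA.mulMap φ t := by
    induction p with
    | nil a => exact vert a
    | cons p β a ih =>
      intro t
      simp only [GPA.mk_apathElt_cons, map_mul, Module.End.mul_apply, ih, arrow, vert, mul_assoc]
  have linearMaps_eq : GPA.mulMap φ ∘ₗ LinearMap.applyₗ t ∘ₗ (GPA.tensorAction φ).toLinearMap =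
      LinearMap.mulRight k (GPA.mulMap φ t) ∘ₗ φ.toLinearMap :=
    GPA.linearMap_ext fun p => path p t
  exact LinearMap.congr_fun linearMaps_eq g

variable {S : V → Type*} [∀ v, Fintype (S v)] [∀ v, Quiver (S v)]
  {π : ∀ v, PathAlg k (S v) →ₐ[k] A v}

theorem IsInterleaving.tensorAction_apply {a b : V} {p : Quiver.Path a b} {x : GPA A k}
    (hx : IsInterleaving π p x) (t : (∀ v, A v) ⊗[k] B) :
    GPA.tensorAction φ x t = Pi.single a 1 ⊗ₜ (φ x * GPA.mulMap φ t) := by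
  induction hx generalizing t with
  | arrow β => exact GPA.tensorAction_arrow φ β t
  | cons _ γ β ih =>
    rw [map_mul, map_mul, Module.End.mul_apply, Module.End.mul_apply, ih]
    simp only [GPA.mulMap_tensorAction, map_mul, mul_assoc]

theorem GPA.tensorAction_eq_zero {I : Set (PathRel k V)} {x : GPA A k}
    (hx : x ∈ interleavedRelations π I) (hφ : φ x = 0) : GPA.tensorAction φ x = 0 := by
  obtain ⟨ρ, -, f, hf, rfl⟩ := hx
  refine LinearMap.ext fun t => ?_
  calc GPA.tensorAction φ (∑ p ∈ ρ.comb.support, ρ.comb p • f p) t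
      = ∑ p ∈ ρ.comb.support, ρ.comb p •
          ((Pi.single ρ.source 1 : ∀ v, A v) ⊗ₜ[k] (φ (f p) * GPA.mulMap φ t)) := by
        rw [map_sum, LinearMap.sum_apply]
        refine Finset.sum_congr rfl fun p hp => ?_
        rw [map_smul, LinearMap.smul_apply, (hf p hp).tensorAction_apply]
    _ = (Pi.single ρ.source 1 : ∀ v, A v) ⊗ₜ[k]
          (φ (∑ p ∈ ρ.comb.support, ρ.comb p • f p) * GPA.mulMap φ t) := by
        simp only [map_sum, map_smul, Finset.sum_mul, smul_mul_assoc, TensorProduct.tmul_sum,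
          TensorProduct.tmul_smul]
    _ = 0 := by rw [hφ, zero_mul, TensorProduct.tmul_zero]

end Splitting

section Projective

variable {k : Type*} [Field k] {V : Type*} [Fintype V] [Quiver V]
  {A : V → Type*} [∀ v, Ring (A v)] [∀ v, Algebra k (A v)]
  {S : V → Type*} [∀ v, Fintype (S v)] [∀ v, Quiver (S v)]
  (π : ∀ v, PathAlg k (S v) →ₐ[k] A v) (I : Set (PathRel k V))

theorem GBPA.mk_eq_zero {x : GPA A k} (hx : x ∈ interleavedRelations π I) :
    GBPA.mk π I x = 0 := by
  rw [← map_zero (GBPA.mk π I)]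
  exact (RingCon.eq (gbpIdeal π I).ringCon).2
    ((TwoSidedIdeal.mem_iff _ _).1 (TwoSidedIdeal.subset_span hx))

/-- The action of `Λ` on `A_𝒜 ⊗ Λ` induced by `GPA.tensorAction`. -/
def GBPA.tensorAction [DecidableEq V] : GBPA π I →ₐ[k] Module.End k ((∀ v, A v) ⊗[k] GBPA π I) :=
  quotientSpanLift (S := Module.End k ((∀ v, A v) ⊗[k] GBPA π I))
    (GPA.tensorAction (GBPA.mk π I)) fun _ hx =>
      GPA.tensorAction_eq_zero _ hx (GBPA.mk_eq_zero π I hx)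

theorem GBPA.tensorAction_mk [DecidableEq V] (g : GPA A k) :
    GBPA.tensorAction π I (GBPA.mk π I g) = GPA.tensorAction (GBPA.mk π I) g := rfl

/-- `Λ` as a left module over `A_𝒜`, through the canonical homomorphism `A_𝒜 → Λ`. -/
instance : Module (∀ v, A v) (GBPA π I) := Module.compHom _ (GBPA.incl π I).toRingHom

instance GBPA.projective : Module.Projective (∀ v, A v) (GBPA π I) := by
  classical
  let μ : (∀ v, A v) ⊗[k] GBPA π I →ₗ[∀ v, A v] GBPA π I :=
    { toFun := GPA.mulMap (GBPA.mk π I)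
      map_add' := map_add _
      map_smul' := GPA.mulMap_smul (GBPA.mk π I) }
  let σ : GBPA π I →ₗ[∀ v, A v] (∀ v, A v) ⊗[k] GBPA π I :=
    { toFun := fun s => GBPA.tensorAction π I s (1 ⊗ₜ 1)
      map_add' := fun s s' => by rw [map_add, LinearMap.add_apply]
      map_smul' := fun r s => by
        change GBPA.tensorAction π I (GBPA.mk π I (GPA.incl A k r) * s) (1 ⊗ₜ 1) = _
        rw [map_mul, Module.End.mul_apply, GBPA.tensorAction_mk, GPA.tensorAction_incl,
          RingHom.id_apply] }
  refine Module.Projective.of_split σ μ (LinearMap.ext fun s => ?_)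
  obtain ⟨g, rfl⟩ := (gbpIdeal π I).ringCon.mk'_surjective s
  change GPA.mulMap (GBPA.mk π I) (GPA.tensorAction (GBPA.mk π I) g (1 ⊗ₜ 1)) = GBPA.mk π I g
  rw [GPA.mulMap_tensorAction, GPA.mulMap_tmul, map_one, map_one, mul_one, mul_one]

end Projective

/-! ## Exactness of extension of scalars -/

section ExtendScalars

variable {R S : Type*} [Ring R] [Ring S] (f : R →+* S)

section Lift

variable {M : Type*} [AddCommGroup M] [Module Rᵐᵒᵖ M]

theorem ExtendScalars.tmul_add (m : M) (s t : S) :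
    ExtendScalars.tmul f m (s + t) = ExtendScalars.tmul f m s + ExtendScalars.tmul f m t := by
  simp only [ExtendScalars.tmul, TensorProduct.add_tmul, map_add]

theorem ExtendScalars.add_tmul (m n : M) (s : S) :
    ExtendScalars.tmul f (m + n) s = ExtendScalars.tmul f m s + ExtendScalars.tmul f n s := by
  simp only [ExtendScalars.tmul, TensorProduct.tmul_add, map_add]

variable (M) in
/-- The elementary tensors of `M ⊗_R S`, as a biadditive map. -/
def ExtendScalars.tmulHom : M →+ S →+ ExtendScalars f M :=
  AddMonoidHom.mk' (fun m => AddMonoidHom.mk' (ExtendScalars.tmul f m) (ExtendScalars.tmul_add f m))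
    fun m n => AddMonoidHom.ext (ExtendScalars.add_tmul f m n)

theorem ExtendScalars.tmulHom_apply (m : M) (s : S) :
    ExtendScalars.tmulHom f M m s = ExtendScalars.tmul f m s := rfl

variable {f} {E : Type*} [AddCommGroup E]

theorem ExtendScalars.addHom_ext {g h : ExtendScalars f M →+ E}
    (H : ∀ m s, g (ExtendScalars.tmul f m s) = h (ExtendScalars.tmul f m s)) : g = h := by
  ext x
  obtain ⟨x, rfl⟩ := Submodule.mkQ_surjective _ x
  induction x with
  | zero => simp only [map_zero]
  | tmul s m => exact H m s
  | add x y hx hy => rw [map_add, map_add, map_add, hx, hy]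

/-- The additive map on `M ⊗_R S` induced by a balanced biadditive map. -/
def ExtendScalars.liftAddHom (F : M →+ S →+ E)
    (balanced : ∀ m r s, F (op r • m) s = F m (f r * s)) : ExtendScalars f M →+ E :=
  let F' : S ⊗[ℤ] M →+ E := TensorProduct.liftAddHom F.flip fun n s m => by
    simp only [AddMonoidHom.flip_apply, map_zsmul, AddMonoidHom.zsmul_apply]
  QuotientAddGroup.lift (balancedRel f M).toAddSubgroup F' fun x hx => by
    change x ∈ Submodule.span _ _ at hx
    induction hx using Submodule.closure_induction with
    | zero => exact map_zero F'
    | add x y _ _ hx hy => exact (map_add F' x y).trans (by rw [hx, hy, add_zero])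
    | smul_mem t x hx =>
      obtain ⟨s, r, m, rfl⟩ := hx
      have relation : t • (s ⊗ₜ[ℤ] (op r • m) - (f r * s) ⊗ₜ[ℤ] m) =
          (s * t.unop) ⊗ₜ[ℤ] (op r • m) - (f r * (s * t.unop)) ⊗ₜ[ℤ] m := by
        rw [smul_sub, TensorProduct.smul_tmul', TensorProduct.smul_tmul', ← mul_assoc]
        rfl
      change F' _ = 0
      rw [relation, map_sub, sub_eq_zero]
      exact balanced m r (s * t.unop)

theorem ExtendScalars.liftAddHom_tmul (F : M →+ S →+ E)
    (balanced : ∀ m r s, F (op r • m) s = F m (f r * s)) (m : M) (s : S) :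
    ExtendScalars.liftAddHom F balanced (ExtendScalars.tmul f m s) = F m s := rfl

end Lift

variable {M N : Type*} [AddCommGroup M] [Module Rᵐᵒᵖ M] [AddCommGroup N] [Module Rᵐᵒᵖ N]

variable (R M) in
/-- The right action `m ↦ (r ↦ m r)`, as a biadditive map. -/
def rightSMulHom : M →+ R →+ M :=
  ((smulAddHom Rᵐᵒᵖ M).comp (opAddEquiv : R ≃+ Rᵐᵒᵖ).toAddMonoidHom).flip

theorem rightSMulHom_apply (m : M) (r : R) : rightSMulHom R M m r = op r • m := rfl

section DualBasis

variable {f} {ι : Type*} (b : ι → S)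

variable (f M) in
/-- The map `(mⱼ)ⱼ ↦ ∑ j, mⱼ ⊗ bⱼ` to `M ⊗_R S` from a direct sum of copies of `M`. -/
def ExtendScalars.ofFinsupp : (ι →₀ M) →+ ExtendScalars f M :=
  Finsupp.liftAddHom fun j => (ExtendScalars.tmulHom f M).flip (b j)

theorem ExtendScalars.ofFinsupp_single (j : ι) (m : M) :
    ExtendScalars.ofFinsupp f M b (Finsupp.single j m) = ExtendScalars.tmul f m (b j) :=
  Finsupp.liftAddHom_apply_single _ _ _

theorem ExtendScalars.ofFinsupp_mapRange (g : M →ₗ[Rᵐᵒᵖ] N) (v : ι →₀ M) :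
    ExtendScalars.ofFinsupp f N b (Finsupp.mapRange.addMonoidHom g.toAddMonoidHom v) =
      ExtendScalars.map f g (ExtendScalars.ofFinsupp f M b v) := by
  induction v using Finsupp.induction_linear with
  | zero => simp only [map_zero]
  | add v w hv hw => simp only [map_add, hv, hw]
  | single j m =>
    rw [Finsupp.mapRange.addMonoidHom_apply, Finsupp.mapRange_single,
      ExtendScalars.ofFinsupp_single, ExtendScalars.ofFinsupp_single]
    rfl

theorem ExtendScalars.ofFinsupp_mapRange_rightSMulHom [Module R S]
    (hf : ∀ (r : R) (s : S), r • s = f r * s) (m : M) (v : ι →₀ R) :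
    ExtendScalars.ofFinsupp f M b (Finsupp.mapRange.addMonoidHom (rightSMulHom R M m) v) =
      ExtendScalars.tmul f m (Finsupp.linearCombination R b v) := by
  induction v using Finsupp.induction_linear with
  | zero => simp only [map_zero, ← ExtendScalars.tmulHom_apply]
  | add v w hv hw => simp only [map_add, hv, hw, ← ExtendScalars.tmulHom_apply]
  | single j r =>
    rw [Finsupp.mapRange.addMonoidHom_apply, Finsupp.mapRange_single, rightSMulHom_apply,
      ExtendScalars.ofFinsupp_single, ExtendScalars.smul_tmul, ← hf,
      Finsupp.linearCombination_single]

variable [Module R S] (hf : ∀ (r : R) (s : S), r • s = f r * s) (σ : S →ₗ[R] ι →₀ R)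

variable (M) in
/-- The map `m ⊗ s ↦ (m σ(s)ⱼ)ⱼ` from `M ⊗_R S` to a direct sum of copies of `M`, for a linear map
`σ` from `S` to a free module. -/
def ExtendScalars.toFinsupp : ExtendScalars f M →+ (ι →₀ M) :=
  ExtendScalars.liftAddHom
    (AddMonoidHom.mk'
      (fun m => (Finsupp.mapRange.addMonoidHom (rightSMulHom R M m)).comp σ.toAddMonoidHom)
      fun m n => AddMonoidHom.ext fun s => Finsupp.ext fun j => by
        simp [rightSMulHom_apply])
    fun m r s => Finsupp.ext fun j => by
      simp [rightSMulHom_apply, ← hf, mul_smul]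

theorem ExtendScalars.toFinsupp_tmul (m : M) (s : S) :
    ExtendScalars.toFinsupp M hf σ (ExtendScalars.tmul f m s) =
      Finsupp.mapRange.addMonoidHom (rightSMulHom R M m) (σ s) :=
  ExtendScalars.liftAddHom_tmul _ _ m s

theorem ExtendScalars.ofFinsupp_toFinsupp
    (dual : ∀ s, Finsupp.linearCombination R b (σ s) = s) (x : ExtendScalars f M) :
    ExtendScalars.ofFinsupp f M b (ExtendScalars.toFinsupp M hf σ x) = x := by
  have comp_eq_id : (ExtendScalars.ofFinsupp f M b).comp (ExtendScalars.toFinsupp M hf σ) =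
      AddMonoidHom.id _ := ExtendScalars.addHom_ext fun m s => by
    rw [AddMonoidHom.comp_apply, ExtendScalars.toFinsupp_tmul,
      ExtendScalars.ofFinsupp_mapRange_rightSMulHom b hf, dual, AddMonoidHom.id_apply]
  exact DFunLike.congr_fun comp_eq_id x

theorem ExtendScalars.toFinsupp_map (g : M →ₗ[Rᵐᵒᵖ] N) (x : ExtendScalars f M) :
    ExtendScalars.toFinsupp N hf σ (ExtendScalars.map f g x) =
      Finsupp.mapRange.addMonoidHom g.toAddMonoidHom (ExtendScalars.toFinsupp M hf σ x) := by
  have comp_eq : (ExtendScalars.toFinsupp N hf σ).comp (ExtendScalars.map f g).toAddMonoidHom =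
      (Finsupp.mapRange.addMonoidHom g.toAddMonoidHom).comp (ExtendScalars.toFinsupp M hf σ) :=
    ExtendScalars.addHom_ext fun m s => Finsupp.ext fun j => (map_smul g (op (σ s j)) m).symm
  exact DFunLike.congr_fun comp_eq x

end DualBasis

theorem exact_finsupp_mapRange {ι L M N : Type*} [AddCommMonoid L] [AddCommMonoid M]
    [AddCommMonoid N] {g : L →+ M} {h : M →+ N} (exact : Function.Exact g h) :
    Function.Exact (Finsupp.mapRange.addMonoidHom g : (ι →₀ L) →+ (ι →₀ M))
      (Finsupp.mapRange.addMonoidHom h) := by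
  intro y
  constructor
  · intro hy
    choose x hx using fun j => (exact (y j)).1 (DFunLike.congr_fun hy j)
    refine ⟨y.sum fun j _ => Finsupp.single j (x j), ?_⟩
    simp only [Finsupp.sum, map_sum, Finsupp.mapRange.addMonoidHom_apply, Finsupp.mapRange_single,
      hx]
    exact y.sum_single
  · rintro ⟨x, rfl⟩
    exact Finsupp.ext fun j => exact.apply_apply_eq_zero (x j)

theorem ExtendScalars.map_exact [Module R S] [Module.Projective R S]
    (hf : ∀ (r : R) (s : S), r • s = f r * s) {L : Type*} [AddCommGroup L] [Module Rᵐᵒᵖ L]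
    {g : L →ₗ[Rᵐᵒᵖ] M} {h : M →ₗ[Rᵐᵒᵖ] N} (exact : Function.Exact g h) :
    Function.Exact (ExtendScalars.map f g) (ExtendScalars.map f h) := by
  obtain ⟨σ, dual⟩ := Module.projective_def.1 ‹Module.Projective R S›
  have exact_finsupp := exact_finsupp_mapRange (ι := S) (g := g.toAddMonoidHom)
    (h := h.toAddMonoidHom) exact
  intro y
  constructor
  · intro hy
    obtain ⟨v, hv⟩ := (exact_finsupp (ExtendScalars.toFinsupp M hf σ y)).1 (by
      rw [← ExtendScalars.toFinsupp_map, hy, map_zero])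
    exact ⟨ExtendScalars.ofFinsupp f L id v, by
      rw [← ExtendScalars.ofFinsupp_mapRange, hv,
        ExtendScalars.ofFinsupp_toFinsupp id hf σ dual]⟩
  · rintro ⟨x, rfl⟩
    rw [← ExtendScalars.ofFinsupp_toFinsupp id hf σ dual (ExtendScalars.map f h _),
      ExtendScalars.toFinsupp_map, ExtendScalars.toFinsupp_map,
      exact_finsupp.apply_apply_eq_zero, map_zero]

end ExtendScalars

section Cone

open Limits

variable {k : Type u} [Field k] {V : Type v} [Fintype V] [Quiver.{w} V]
  {A : V → Type x} [∀ v, Ring (A v)] [∀ v, Algebra k (A v)]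
  {S : V → Type y} [∀ v, Fintype (S v)] [∀ v, Quiver.{z} (S v)]
  (π : ∀ v, PathAlg k (S v) →ₐ[k] A v) (I : Set (PathRel k V)) (i : V)

theorem bigConeFunctor_map_exact {L M N : ModuleCat.{m} (A i)ᵐᵒᵖ} (f : L ⟶ M) (g : M ⟶ N)
    (exact : Function.Exact f.hom g.hom) :
    Function.Exact ((bigConeFunctor π I i).map f).hom ((bigConeFunctor π I i).map g).hom :=
  let restrict := ModuleCat.restrictScalars (RingHom.op (Pi.evalRingHom A i))
  ExtendScalars.map_exact (GBPA.incl π I : (∀ v, A v) →+* GBPA π I) (fun _ _ => rfl)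
    (g := (restrict.map f).hom) (h := (restrict.map g).hom) exact

instance bigConeFunctor_additive : (bigConeFunctor.{u, v, w, x, y, z, m} π I i).Additive where
  map_add {M N f g} := by
    let restrict := ModuleCat.restrictScalars (RingHom.op (Pi.evalRingHom A i))
    apply ModuleCat.hom_ext
    apply ExtendScalars.hom_ext
    intro m s
    exact ExtendScalars.add_tmul (M := restrict.obj N) _ (f.hom m) (g.hom m) s

theorem bigConeFunctor_preservesFinite :
    PreservesFiniteLimits (bigConeFunctor.{u, v, w, x, y, z, m} π I i) ∧
      PreservesFiniteColimits (bigConeFunctor.{u, v, w, x, y, z, m} π I i) :=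
  ((Functor.exact_tfae (bigConeFunctor.{u, v, w, x, y, z, m} π I i)).out 1 3).1
    fun (T : ShortComplex _) hT =>
    (ShortComplex.ShortExact.moduleCat_exact_iff_function_exact _).2 <|
      bigConeFunctor_map_exact π I i T.f T.g <|
        (ShortComplex.ShortExact.moduleCat_exact_iff_function_exact _).1 hT

theorem coneFunctor_exact [IsNoetherianRing (A i)ᵐᵒᵖ] :
    exactFunctor (FGModuleCat.{m} (A i)ᵐᵒᵖ) (FGModuleCat (GBPA π I)ᵐᵒᵖ)
      (coneFunctor.{u, v, w, x, y, z, m} π I i) := by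
  obtain ⟨_, _⟩ := bigConeFunctor_preservesFinite.{u, v, w, x, y, z, m} π I i
  have : PreservesFiniteLimits (ModuleCat.isFG.{m} (A i)ᵐᵒᵖ).ι :=
    inferInstanceAs (PreservesFiniteLimits (forget₂ (FGModuleCat (A i)ᵐᵒᵖ) (ModuleCat (A i)ᵐᵒᵖ)))
  have : PreservesFiniteColimits (ModuleCat.isFG.{m} (A i)ᵐᵒᵖ).ι :=
    inferInstanceAs (PreservesFiniteColimits
      (forget₂ (FGModuleCat (A i)ᵐᵒᵖ) (ModuleCat (A i)ᵐᵒᵖ)))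
  have : PreservesFiniteLimits (coneFunctor.{u, v, w, x, y, z, m} π I i ⋙ (ModuleCat.isFG _).ι) :=
    inferInstanceAs (PreservesFiniteLimits ((ModuleCat.isFG _).ι ⋙ bigConeFunctor π I i))
  have : PreservesFiniteColimits
      (coneFunctor.{u, v, w, x, y, z, m} π I i ⋙ (ModuleCat.isFG _).ι) :=
    inferInstanceAs (PreservesFiniteColimits ((ModuleCat.isFG _).ι ⋙ bigConeFunctor π I i))
  exact ⟨⟨fun J _ _ => preservesLimitsOfShape_of_reflects_of_preserves _ (ModuleCat.isFG _).ι⟩,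
    ⟨fun J _ _ => preservesColimitsOfShape_of_reflects_of_preserves _ (ModuleCat.isFG _).ι⟩⟩

end Cone

end GBP

end

theorem proposition4p4_general
    {k : Type u} [Field k] {V : Type v} [Fintype V] [Quiver.{w} V]
    {A : V → Type x} [∀ v, Ring (A v)] [∀ v, Algebra k (A v)]
    {S : V → Type y} [∀ v, Fintype (S v)] [∀ v, Quiver.{z} (S v)]
    (π : ∀ v, GBP.PathAlg k (S v) →ₐ[k] A v) (I : Set (GBP.PathRel k V)) (i : V)
    [IsNoetherianRing (A i)ᵐᵒᵖ] :
    exactFunctor (FGModuleCat.{m} (A i)ᵐᵒᵖ) (FGModuleCat (GBP.GBPA π I)ᵐᵒᵖ)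
      (GBP.coneFunctor.{u, v, w, x, y, z, m} π I i) ∧
    ∀ (L M N : FGModuleCat.{m} (A i)ᵐᵒᵖ) (f : L ⟶ M) (g : M ⟶ N),
      Function.Exact f.hom.hom g.hom.hom →
        Function.Exact ((GBP.coneFunctor.{u, v, w, x, y, z, m} π I i).map f).hom.hom
          ((GBP.coneFunctor.{u, v, w, x, y, z, m} π I i).map g).hom.hom :=
  ⟨GBP.coneFunctor_exact π I i, fun _ _ _ f g => GBP.bigConeFunctor_map_exact π I i f.hom g.hom⟩

theorem proposition4p4
    -- the algebraically closed ground field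
    {k : Type u} [Field k] [IsAlgClosed k]
    -- the finite acyclic quiver with vertex set `V`
    {V : Type v} [Fintype V] [Quiver.{w} V] [∀ a b : V, Finite (a ⟶ b)]
    (acyclic : ∀ (a : V) (p : Quiver.Path a a), p = Quiver.Path.nil)
    -- the finite-dimensional algebras `A v`, presented as `kS_v / Ω_v` with `S v` a finite quiver
    -- and `Ω_v = ker (π v)` an admissible ideal
    {A : V → Type x} [∀ v, Ring (A v)] [∀ v, Algebra k (A v)] [∀ v, FiniteDimensional k (A v)]
    {S : V → Type y} [∀ v, Fintype (S v)] [∀ v, Quiver.{z} (S v)]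
    [∀ (v : V) (a b : S v), Finite (a ⟶ b)]
    (π : ∀ v, GBP.PathAlg k (S v) →ₐ[k] A v)
    (surjective : ∀ v, Function.Surjective (π v))
    (admissible : ∀ v, GBP.IsAdmissible (TwoSidedIdeal.ker (π v)))
    -- the relations on `V`, which generate an admissible ideal of the path algebra
    (I : Set (GBP.PathRel k V))
    (admissible_I : GBP.IsAdmissible (TwoSidedIdeal.span (GBP.PathRel.elt '' I)))
    (i : V) :
    -- the cone functor is exact, that is, it preserves finite limits and finite colimits
    exactFunctor (FGModuleCat.{m} (A i)ᵐᵒᵖ) (FGModuleCat (GBP.GBPA π I)ᵐᵒᵖ)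
      (GBP.coneFunctor.{u, v, w, x, y, z, m} π I i) ∧
    -- equivalently, it takes exact sequences `L → M → N` to exact sequences
    ∀ (L M N : FGModuleCat.{m} (A i)ᵐᵒᵖ) (f : L ⟶ M) (g : M ⟶ N),
      Function.Exact f.hom.hom g.hom.hom →
        Function.Exact ((GBP.coneFunctor.{u, v, w, x, y, z, m} π I i).map f).hom.hom
          ((GBP.coneFunctor.{u, v, w, x, y, z, m} π I i).map g).hom.hom := by
  have : IsNoetherianRing (A i)ᵐᵒᵖ := IsNoetherianRing.of_finite k _
  exact proposition4p4_general π I i
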